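/- Let $\mathcal P$ be a probability distribution on $\mathbb R^d$ with second moment matrix $\Sigma=\mathbb E_{Y\sim\mathcal P}[YY^\top]$, write $\sigma_1(\cdot)$ for the maximum singular value of a matrix, and let $\rho\ge 0$ with $\rho^2=\sigma_1(\Sigma)$. Suppose that for some real $\alpha>\rho$ we have $\alpha\le\|Y\|\le 1$ almost surely for $Y\sim\mathcal P$, where $\|\cdot\|$ is the Euclidean norm. Let $Y_1,\dots,Y_K$ be an i.i.d. sample from $\mathcal P$ and let $$Q_K=\sum_{k=1}^K Y_kY_k^\top .$$ If $$K>\frac{4}{\rho^2}\log\frac{11}{\rho^2(\alpha^2-\rho^2)},$$ then $\sigma_1(Q_K)/K$ is integrable and $$\mathbb E\left[\frac{\sigma_1(Q_K)}{K}\right]\le 5\rho^2 .$$ (The threshold on $K$ does not involve the ambient dimension $d$.) -/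

import Mathlib

open MeasureTheory ProbabilityTheory

/-- The maximum singular value `σ₁(A)` of a real square matrix `A`, acting on `ℝ^d` with the
Euclidean norm. Mathlib lists singular values in decreasing order, starting from index `0`. -/
noncomputable def sigmaOne {d : ℕ} (A : Matrix (Fin d) (Fin d) ℝ) : ℝ :=
  (Matrix.toEuclideanLin A).singularValues 0

/-- The rank-one matrix `y yᵀ`. -/
def outerSelf {d : ℕ} (y : EuclideanSpace ℝ (Fin d)) : Matrix (Fin d) (Fin d) ℝ :=
  Matrix.of fun i j => y i * y j

/-- The second moment matrix `Σ = E_{Y ∼ P}[Y Yᵀ]`, the expectation being taken entrywise. -/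
noncomputable def secondMoment {d : ℕ} (P : Measure (EuclideanSpace ℝ (Fin d))) :
    Matrix (Fin d) (Fin d) ℝ :=
  Matrix.of fun i j => ∫ y, outerSelf y i j ∂P

/-- The matrix `Q_K = ∑ₖ Yₖ Yₖᵀ` of the points `Y₁, …, Y_K`. -/
def sampleSecondMoment {d K : ℕ} (Y : Fin K → EuclideanSpace ℝ (Fin d)) :
    Matrix (Fin d) (Fin d) ℝ :=
  ∑ k, outerSelf (Y k)

/-! Write `r = ρ² = σ₁(Σ)` and `c = e - 1`. The core is the dimension-free bound `E exp σ₁(Q_K) ≤ (1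
+ c r)^K / r`. Jensen's inequality then gives `E σ₁(Q_K) ≤ log (1/r) + c K r`, and the threshold on
`K` makes the logarithm less than `K r / 4`.

For the core, follow the trace of the exponential series without its constant term, so that `tr 1 =
d` never enters. Adding `y yᵀ` with `‖y‖ ≤ 1` to `A ≥ 0` raises this trace by at most `c (‖y‖² + yᵀ
F(A) y)`, `F` being the (truncated) series (`trace_expTrunc_add_vecMulVec_le`). Averaging over a
fresh independent `y` turns `yᵀ F(A) y` into `tr (F(A) Σ) ≤ r tr F(A)`, a linear recursion in the
number of samples.

The rank-one estimate compares `y yᵀ` with `1`, but only inside quadratic forms at `y`, where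
Chebyshev's inequality for the spectral measure of `A` at `y` replaces operator monotonicity, which
fails for powers. -/

open scoped Matrix

/-! ### Rank-one updates, spectral moments and traces -/

section MatrixInequalities

variable {ι : Type*} [Fintype ι] [DecidableEq ι]

theorem Matrix.trace_mul_vecMulVec_self {ι : Type*} [Fintype ι] (M : Matrix ι ι ℝ) (y : ι → ℝ) :
    (M * Matrix.vecMulVec y y).trace = y ⬝ᵥ M *ᵥ y := by
  rw [Matrix.mul_vecMulVec, Matrix.trace_vecMulVec, dotProduct_comm]

/-- Moments of a positive semidefinite matrix at a vector, as moments of its spectral measure. -/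
theorem Matrix.PosSemidef.exists_moment_eq {A : Matrix ι ι ℝ} (hA : A.PosSemidef) (y : ι → ℝ) :
    ∃ w l : ι → ℝ, (∀ k, 0 ≤ w k) ∧ (∀ k, 0 ≤ l k) ∧
      ∀ j : ℕ, y ⬝ᵥ (A ^ j) *ᵥ y = ∑ k, w k * l k ^ j := by
  set U : Matrix ι ι ℝ := (hA.1.eigenvectorUnitary : Matrix ι ι ℝ) with hU
  set D : Matrix ι ι ℝ := Matrix.diagonal hA.1.eigenvalues with hD
  have hsp : A = U * D * star U := by
    have := hA.1.spectral_theorem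
    rw [Unitary.conjStarAlgAut_apply] at this
    simpa [hU, hD, Function.comp_def] using this
  have hUU : star U * U = 1 := by simp [hU]
  have hUU' : U * star U = 1 := by simp [hU]
  have hpow : ∀ j : ℕ, A ^ j = U * D ^ j * star U := by
    intro j
    induction j with
    | zero => simp [hUU']
    | succ j ih =>
      calc A ^ (j + 1) = U * D ^ j * star U * (U * D * star U) := by rw [pow_succ, ih, ← hsp]
        _ = U * D ^ j * (star U * U) * D * star U := by simp only [mul_assoc]
        _ = _ := by rw [hUU, mul_one, pow_succ]; simp only [mul_assoc]
  refine ⟨fun k => (star U *ᵥ y) k ^ 2, hA.1.eigenvalues, fun k => sq_nonneg _,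
    hA.eigenvalues_nonneg, fun j => ?_⟩
  have hst : star U = Uᵀ := by
    ext a b; simp [Matrix.star_apply]
  rw [hpow, ← Matrix.mulVec_mulVec, ← Matrix.mulVec_mulVec, Matrix.dotProduct_mulVec,
    ← Matrix.mulVec_transpose, ← hst, hD, Matrix.diagonal_pow]
  simp only [dotProduct, Matrix.mulVec_diagonal, Pi.pow_apply]
  exact Finset.sum_congr rfl fun k _ => by ring

theorem Matrix.PosSemidef.moment_nonneg {A : Matrix ι ι ℝ} (hA : A.PosSemidef) (y : ι → ℝ)
    (j : ℕ) : 0 ≤ y ⬝ᵥ (A ^ j) *ᵥ y := by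
  simpa using (hA.pow j).dotProduct_mulVec_nonneg y

/-- Chebyshev's inequality for the moments of a positive semidefinite matrix. -/
theorem Matrix.PosSemidef.moment_mul_moment_le {A : Matrix ι ι ℝ} (hA : A.PosSemidef)
    (y : ι → ℝ) (i j : ℕ) :
    (y ⬝ᵥ (A ^ i) *ᵥ y) * (y ⬝ᵥ (A ^ j) *ᵥ y) ≤ (y ⬝ᵥ y) * (y ⬝ᵥ (A ^ (i + j)) *ᵥ y) := by
  obtain ⟨w, l, hw, hl, h⟩ := hA.exists_moment_eq y
  have h0 : y ⬝ᵥ y = ∑ k, w k := by simpa using h 0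
  rw [h, h, h, h0]
  -- Symmetrized form of Chebyshev's inequality: `x ^ i` and `x ^ j` are both monotone on `[0, ∞)`,
  -- so the two differences have the same sign.
  have hnn : 0 ≤ ∑ a, ∑ b, w a * w b * ((l a ^ i - l b ^ i) * (l a ^ j - l b ^ j)) := by
    refine Finset.sum_nonneg fun a _ => Finset.sum_nonneg fun b _ =>
      mul_nonneg (mul_nonneg (hw a) (hw b)) ?_
    rcases le_total (l a) (l b) with hab | hab
    · exact mul_nonneg_of_nonpos_of_nonpos
        (sub_nonpos.2 (pow_le_pow_left₀ (hl a) hab i)) (sub_nonpos.2 (pow_le_pow_left₀ (hl a) hab j))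
    · exact mul_nonneg
        (sub_nonneg.2 (pow_le_pow_left₀ (hl b) hab i)) (sub_nonneg.2 (pow_le_pow_left₀ (hl b) hab j))
  have hexp : ∑ a, ∑ b, w a * w b * ((l a ^ i - l b ^ i) * (l a ^ j - l b ^ j)) =
      2 * ((∑ k, w k) * ∑ k, w k * l k ^ (i + j)) -
        2 * ((∑ k, w k * l k ^ i) * ∑ k, w k * l k ^ j) := by
    have e1 := Finset.sum_mul_sum Finset.univ Finset.univ w (fun k => w k * l k ^ (i + j))
    have e1' := e1
    rw [Finset.sum_comm] at e1'
    have e2 := Finset.sum_mul_sum Finset.univ Finset.univ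
      (fun k => w k * l k ^ i) (fun k => w k * l k ^ j)
    have e2' := e2
    rw [Finset.sum_comm] at e2'
    rw [two_mul, two_mul]
    nth_rewrite 1 [e1]
    rw [e1']
    nth_rewrite 1 [e2]
    rw [e2']
    simp only [← Finset.sum_add_distrib, ← Finset.sum_sub_distrib]
    exact Finset.sum_congr rfl fun a _ => Finset.sum_congr rfl fun b _ => by ring
  linarith

theorem Matrix.PosSemidef.moment_mul_shifted_moment_le {A : Matrix ι ι ℝ} (hA : A.PosSemidef)
    {y : ι → ℝ} (hy : y ⬝ᵥ y ≤ 1) (i j : ℕ) :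
    (y ⬝ᵥ (A ^ i) *ᵥ y) * (y ⬝ᵥ ((A + 1) ^ j) *ᵥ y) ≤ y ⬝ᵥ (A ^ i * (A + 1) ^ j) *ᵥ y := by
  have hexp : (A + 1) ^ j = ∑ m ∈ Finset.range (j + 1), (j.choose m : ℝ) • A ^ m := by
    rw [(Commute.one_right A).add_pow]
    refine Finset.sum_congr rfl fun m _ => ?_
    rw [one_pow, mul_one, ← nsmul_eq_mul', ← Nat.cast_smul_eq_nsmul ℝ]
  rw [hexp]
  simp only [Finset.mul_sum, Matrix.sum_mulVec, dotProduct_sum, Matrix.smul_mulVec,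
    dotProduct_smul, smul_eq_mul, mul_smul_comm, ← pow_add]
  refine Finset.sum_le_sum fun m _ => ?_
  have h1 := hA.moment_mul_moment_le y i m
  have h2 := hA.moment_nonneg y (i + m)
  have h3 : (y ⬝ᵥ y) * (y ⬝ᵥ (A ^ (i + m)) *ᵥ y) ≤ y ⬝ᵥ (A ^ (i + m)) *ᵥ y :=
    mul_le_of_le_one_left h2 hy
  have := mul_le_mul_of_nonneg_left (h1.trans h3) (Nat.cast_nonneg (α := ℝ) (j.choose m))
  linarith

/-- Expansion of a power of `A + B` according to the position of the first factor `B`. -/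
theorem add_pow_eq_pow_add_sum {R : Type*} [Ring R] (A B : R) (n : ℕ) :
    (A + B) ^ n = A ^ n + ∑ i ∈ Finset.range n, A ^ i * B * (A + B) ^ (n - 1 - i) := by
  induction n with
  | zero => simp
  | succ n ih =>
    rw [Finset.sum_range_succ']
    have : ∀ i ∈ Finset.range n, A ^ (i + 1) * B * (A + B) ^ (n + 1 - 1 - (i + 1)) =
        A * (A ^ i * B * (A + B) ^ (n - 1 - i)) := by
      intro i _
      rw [show n + 1 - 1 - (i + 1) = n - 1 - i by omega, pow_succ']
      simp only [mul_assoc]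
    rw [Finset.sum_congr rfl this, ← Finset.mul_sum]
    have h2 : ∑ i ∈ Finset.range n, A ^ i * B * (A + B) ^ (n - 1 - i) = (A + B) ^ n - A ^ n := by
      rw [ih]; abel
    rw [h2, pow_succ' (A + B), pow_succ' A]
    simp only [add_tsub_cancel_right, tsub_zero, pow_zero, one_mul]
    noncomm_ring

/-- Splitting at the first factor `y yᵀ` breaks each term into a product of two moments at `y`.
Induction replaces `y yᵀ` by `1` in the second, and Chebyshev merges the product into the matching
term of the expansion of `(A + 1) ^ j`. -/
theorem Matrix.PosSemidef.moment_add_vecMulVec_le {A : Matrix ι ι ℝ} (hA : A.PosSemidef)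
    {y : ι → ℝ} (hy : y ⬝ᵥ y ≤ 1) (j l : ℕ) :
    y ⬝ᵥ (A ^ l * (A + Matrix.vecMulVec y y) ^ j) *ᵥ y ≤ y ⬝ᵥ (A ^ l * (A + 1) ^ j) *ᵥ y := by
  induction j using Nat.strong_induction_on generalizing l with
  | _ j ih =>
    rw [add_pow_eq_pow_add_sum A (Matrix.vecMulVec y y), add_pow_eq_pow_add_sum A 1]
    simp only [mul_add, Matrix.add_mulVec, dotProduct_add, Finset.mul_sum, Matrix.sum_mulVec,
      dotProduct_sum, mul_one]
    gcongr with i hi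
    have hi' : j - 1 - i < j := by have := Finset.mem_range.1 hi; omega
    have e : y ⬝ᵥ (A ^ l * (A ^ i * Matrix.vecMulVec y y *
        (A + Matrix.vecMulVec y y) ^ (j - 1 - i))) *ᵥ y =
        (y ⬝ᵥ (A ^ (l + i)) *ᵥ y) *
          (y ⬝ᵥ ((A + Matrix.vecMulVec y y) ^ (j - 1 - i)) *ᵥ y) := by
      rw [← mul_assoc, ← mul_assoc, ← pow_add, ← Matrix.mulVec_mulVec, ← Matrix.mulVec_mulVec,
        Matrix.vecMulVec_mulVec]
      simp only [Matrix.mulVec_smul, dotProduct_smul, MulOpposite.smul_eq_mul_unop,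
        MulOpposite.unop_op]
    rw [e, ← mul_assoc, ← pow_add]
    refine le_trans ?_ (hA.moment_mul_shifted_moment_le hy _ _)
    refine mul_le_mul_of_nonneg_left ?_ (hA.moment_nonneg _ _)
    simpa using ih _ hi' 0

/-- Effect of a rank-one update on the trace of a power. -/
theorem Matrix.PosSemidef.trace_add_vecMulVec_pow_le {A : Matrix ι ι ℝ} (hA : A.PosSemidef)
    {y : ι → ℝ} (hy : y ⬝ᵥ y ≤ 1) (n : ℕ) :
    ((A + Matrix.vecMulVec y y) ^ n).trace ≤
      (A ^ n).trace + ∑ j ∈ Finset.range n, (n.choose j : ℝ) * (y ⬝ᵥ (A ^ j) *ᵥ y) := by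
  -- Both sides are the quadratic form of `(A + 1) ^ n - A ^ n` at `y`: binomial theorem on the
  -- left, expansion by first factor `1` on the right.
  have hbin : ∑ j ∈ Finset.range n, (n.choose j : ℝ) * (y ⬝ᵥ (A ^ j) *ᵥ y) =
      ∑ i ∈ Finset.range n, y ⬝ᵥ (A ^ i * (A + 1) ^ (n - 1 - i)) *ᵥ y := by
    have h1 := add_pow_eq_pow_add_sum A 1 n
    have h2 := (Commute.one_right A).add_pow n
    rw [Finset.sum_range_succ, h1] at h2
    simp only [one_pow, mul_one, Nat.choose_self, Nat.cast_one] at h2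
    rw [add_comm, add_left_inj] at h2
    rw [← dotProduct_sum, ← Matrix.sum_mulVec, h2, Matrix.sum_mulVec, dotProduct_sum]
    refine Finset.sum_congr rfl fun m _ => ?_
    rw [← nsmul_eq_mul', ← Nat.cast_smul_eq_nsmul ℝ, Matrix.smul_mulVec, dotProduct_smul,
      smul_eq_mul]
  rw [hbin, add_pow_eq_pow_add_sum A (Matrix.vecMulVec y y), Matrix.trace_add, Matrix.trace_sum]
  gcongr with i hi
  have e : (A ^ i * Matrix.vecMulVec y y * (A + Matrix.vecMulVec y y) ^ (n - 1 - i)).trace =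
      y ⬝ᵥ (A ^ i * (A + Matrix.vecMulVec y y) ^ (n - 1 - i)) *ᵥ y := by
    rw [Matrix.trace_mul_comm, ← mul_assoc, Matrix.trace_mul_vecMulVec_self]
    -- Cyclicity leaves the two powers in the opposite order; a quadratic form does not change under
    -- transposition.
    have hs : A ^ i * (A + Matrix.vecMulVec y y) ^ (n - 1 - i) =
        ((A + Matrix.vecMulVec y y) ^ (n - 1 - i) * A ^ i)ᵀ := by
      have hAt : Aᵀ = A := by simpa [Matrix.conjTranspose_eq_transpose_of_trivial] using hA.1.eq
      rw [Matrix.transpose_mul, Matrix.transpose_pow, Matrix.transpose_pow, Matrix.transpose_add,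
        Matrix.transpose_vecMulVec, hAt]
    rw [hs, Matrix.mulVec_transpose, dotProduct_comm y (_ ᵥ* _), ← Matrix.dotProduct_mulVec]
  rw [e]
  exact hA.moment_add_vecMulVec_le hy _ _

theorem Matrix.PosSemidef.trace_mul_nonneg {ι : Type*} [Fintype ι] {M N : Matrix ι ι ℝ} (hM : M.PosSemidef)
    (hN : N.PosSemidef) : 0 ≤ (M * N).trace := by
  obtain ⟨m, v, rfl⟩ := Matrix.posSemidef_iff_eq_sum_vecMulVec.1 hM
  rw [Matrix.trace_mul_comm, Finset.mul_sum, Matrix.trace_sum]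
  refine Finset.sum_nonneg fun i _ => ?_
  rw [star_trivial, Matrix.trace_mul_vecMulVec_self]
  simpa using hN.dotProduct_mulVec_nonneg (v i)

/-- The hypothesis `h` says that `c • 1 - N` is positive semidefinite, and its product with `M` has
nonnegative trace. -/
theorem Matrix.PosSemidef.trace_mul_le {M N : Matrix ι ι ℝ} (hM : M.PosSemidef)
    (hN : N.IsHermitian) {c : ℝ} (h : ∀ x : ι → ℝ, x ⬝ᵥ N *ᵥ x ≤ c * (x ⬝ᵥ x)) :
    (M * N).trace ≤ c * M.trace := by
  have hP : (c • (1 : Matrix ι ι ℝ) - N).PosSemidef := by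
    refine Matrix.PosSemidef.of_dotProduct_mulVec_nonneg ?_ fun x => ?_
    · refine Matrix.IsHermitian.sub ?_ hN
      simp [Matrix.IsHermitian]
    · have := h x
      simp [Matrix.sub_mulVec, Matrix.smul_mulVec]
      linarith
  have := hM.trace_mul_nonneg hP
  rw [mul_sub, Matrix.trace_sub, mul_smul_comm, mul_one, Matrix.trace_smul, smul_eq_mul] at this
  linarith

theorem Matrix.PosSemidef.dotProduct_mulVec_le_trace {M : Matrix ι ι ℝ} (hM : M.PosSemidef)
    (y : ι → ℝ) : y ⬝ᵥ M *ᵥ y ≤ (y ⬝ᵥ y) * M.trace := by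
  rw [← Matrix.trace_mul_vecMulVec_self]
  refine hM.trace_mul_le ?_ fun x => ?_
  · simpa using (Matrix.posSemidef_vecMulVec_self_star y).1
  · rw [Matrix.vecMulVec_mulVec, op_smul_eq_smul, dotProduct_smul, smul_eq_mul,
      dotProduct_comm x y]
    simp only [dotProduct]
    have := Finset.sum_mul_sq_le_sq_mul_sq Finset.univ y x
    simpa only [← sq] using this

/-- The truncated exponential series of `A`, without its constant term. -/
noncomputable def expTrunc (N : ℕ) (A : Matrix ι ι ℝ) : Matrix ι ι ℝ :=
  ∑ j ∈ Finset.range N, ((j + 1).factorial : ℝ)⁻¹ • A ^ (j + 1)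

theorem expTrunc_posSemidef {A : Matrix ι ι ℝ} (hA : A.PosSemidef) (N : ℕ) :
    (expTrunc N A).PosSemidef :=
  Matrix.posSemidef_sum _ fun j _ => (hA.pow (j + 1)).smul (by positivity)

theorem sum_inv_factorial_succ_le (N : ℕ) :
    ∑ i ∈ Finset.range N, ((i + 1).factorial : ℝ)⁻¹ ≤ Real.exp 1 - 1 := by
  have := Real.sum_le_exp_of_nonneg (zero_le_one' ℝ) (N + 1)
  rw [Finset.sum_range_succ'] at this
  simp only [one_pow, one_div, Nat.factorial_zero, Nat.cast_one, inv_one] at this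
  linarith

/-- Effect of a rank-one update on the trace of the truncated exponential. -/
theorem trace_expTrunc_add_vecMulVec_le {A : Matrix ι ι ℝ} (hA : A.PosSemidef)
    {y : ι → ℝ} (hy : y ⬝ᵥ y ≤ 1) (N : ℕ) :
    (expTrunc N (A + Matrix.vecMulVec y y)).trace ≤ (expTrunc N A).trace +
      (Real.exp 1 - 1) * (y ⬝ᵥ y + y ⬝ᵥ (expTrunc N A) *ᵥ y) := by
  set m : ℕ → ℝ := fun j => y ⬝ᵥ (A ^ j) *ᵥ y with hm
  have hm0 : ∀ j, 0 ≤ m j := hA.moment_nonneg y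
  have hstep : (expTrunc N (A + Matrix.vecMulVec y y)).trace ≤ (expTrunc N A).trace +
      ∑ n ∈ Finset.range N, ∑ j ∈ Finset.range (n + 1),
        ((j.factorial : ℝ)⁻¹ * m j) * ((n + 1 - j).factorial : ℝ)⁻¹ := by
    simp only [expTrunc, Matrix.trace_sum, Matrix.trace_smul, smul_eq_mul,
      ← Finset.sum_add_distrib]
    refine Finset.sum_le_sum fun n _ => ?_
    have h := mul_le_mul_of_nonneg_left (hA.trace_add_vecMulVec_pow_le hy (n + 1))
      (by positivity : (0 : ℝ) ≤ ((n + 1).factorial : ℝ)⁻¹)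
    refine h.trans (le_of_eq ?_)
    rw [mul_add, Finset.mul_sum]
    congr 1
    refine Finset.sum_congr rfl fun j hj => ?_
    rw [Nat.cast_choose ℝ (Finset.mem_range.1 hj).le]
    have := Nat.factorial_ne_zero (n + 1)
    field_simp
    rfl
  have hswap : ∑ n ∈ Finset.range N, ∑ j ∈ Finset.range (n + 1),
        ((j.factorial : ℝ)⁻¹ * m j) * ((n + 1 - j).factorial : ℝ)⁻¹ =
      ∑ j ∈ Finset.range N, ((j.factorial : ℝ)⁻¹ * m j) *
        ∑ i ∈ Finset.range (N - j), ((i + 1).factorial : ℝ)⁻¹ := by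
    rw [Finset.sum_comm' (t' := Finset.range N) (s' := fun j => Finset.Ico j N)
      (by intro a b; simp only [Finset.mem_range, Finset.mem_Ico]; omega)]
    refine Finset.sum_congr rfl fun j _ => ?_
    rw [Finset.mul_sum, Finset.sum_Ico_eq_sum_range]
    refine Finset.sum_congr rfl fun i _ => ?_
    rw [show j + i + 1 - j = i + 1 by omega]
  -- The nonnegative term `j = N` is added so that the sum closes up to `y ⬝ᵥ y` plus the form of
  -- `expTrunc N A`.
  have hbound : ∑ j ∈ Finset.range N, ((j.factorial : ℝ)⁻¹ * m j) *
        ∑ i ∈ Finset.range (N - j), ((i + 1).factorial : ℝ)⁻¹ ≤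
      (Real.exp 1 - 1) * ∑ j ∈ Finset.range (N + 1), ((j.factorial : ℝ)⁻¹ * m j) := by
    rw [mul_comm (Real.exp 1 - 1), Finset.sum_mul]
    have hc : 0 ≤ Real.exp 1 - 1 := by have := Real.add_one_le_exp (1 : ℝ); linarith
    refine le_trans (Finset.sum_le_sum fun j _ => mul_le_mul_of_nonneg_left
      (sum_inv_factorial_succ_le (N - j)) (mul_nonneg (by positivity) (hm0 j))) ?_
    rw [Finset.sum_range_succ]
    have : 0 ≤ ((N.factorial : ℝ)⁻¹ * m N) * (Real.exp 1 - 1) :=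
      mul_nonneg (mul_nonneg (by positivity) (hm0 N)) hc
    linarith
  have hfin : ∑ j ∈ Finset.range (N + 1), ((j.factorial : ℝ)⁻¹ * m j) =
      y ⬝ᵥ y + y ⬝ᵥ (expTrunc N A) *ᵥ y := by
    rw [Finset.sum_range_succ', add_comm]
    simp [hm, expTrunc, Matrix.sum_mulVec, dotProduct_sum, Matrix.smul_mulVec]
  rw [← hfin]
  linarith

end MatrixInequalities

/-! ### The largest singular value as operator norm and as eigenvalue -/

section SingularValue

variable {d : ℕ}

theorem sigmaOne_nonneg (A : Matrix (Fin d) (Fin d) ℝ) : 0 ≤ sigmaOne A :=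
  LinearMap.singularValues_nonneg _ _

theorem norm_toEuclideanLin_apply_le (A : Matrix (Fin d) (Fin d) ℝ)
    (x : EuclideanSpace ℝ (Fin d)) : ‖Matrix.toEuclideanLin A x‖ ≤ sigmaOne A * ‖x‖ := by
  set T := Matrix.toEuclideanLin A with hT
  set hS := T.isSymmetric_adjoint_comp_self
  have hn : Module.finrank ℝ (EuclideanSpace ℝ (Fin d)) = d := by simp
  set b := hS.eigenvectorBasis hn with hb
  refine le_of_sq_le_sq ?_ (mul_nonneg (sigmaOne_nonneg A) (norm_nonneg x))
  have h1 : ‖T x‖ ^ 2 = inner ℝ x ((LinearMap.adjoint T ∘ₗ T) x) := by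
    rw [LinearMap.comp_apply, LinearMap.adjoint_inner_right, real_inner_self_eq_norm_sq]
  rw [h1, ← b.sum_inner_mul_inner x, mul_pow, ← b.sum_sq_norm_inner_right x, Finset.mul_sum]
  refine Finset.sum_le_sum fun i _ => ?_
  have h2 : inner ℝ (b i) ((LinearMap.adjoint T ∘ₗ T) x) =
      hS.eigenvalues hn i * inner ℝ (b i) x := by
    rw [← hS (b i) x, hS.apply_eigenvectorBasis hn i]
    simp [inner_smul_left, hb]
  have h3 : hS.eigenvalues hn i ≤ sigmaOne A ^ 2 := by
    rw [← T.sq_singularValues_fin hn i]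
    exact pow_le_pow_left₀ (T.singularValues_nonneg _) (T.singularValues_antitone (Nat.zero_le _)) 2
  rw [h2, real_inner_comm]
  have h4 := mul_le_mul_of_nonneg_right h3 (sq_nonneg (inner ℝ (b i) x))
  simp only [Real.norm_eq_abs, sq_abs]
  linarith

theorem exists_adjoint_comp_self_eq_sigmaOne_sq [NeZero d] (A : Matrix (Fin d) (Fin d) ℝ) :
    ∃ v : EuclideanSpace ℝ (Fin d), v ≠ 0 ∧
      LinearMap.adjoint (Matrix.toEuclideanLin A) (Matrix.toEuclideanLin A v) =
        sigmaOne A ^ 2 • v := by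
  have hn : 0 < Module.finrank ℝ (EuclideanSpace ℝ (Fin d)) := by
    simpa using Nat.pos_of_ne_zero (NeZero.ne d)
  obtain ⟨v, hv⟩ := (LinearMap.hasEigenvalue_adjoint_comp_self_sq_singularValues
    (Matrix.toEuclideanLin A) hn).exists_hasEigenvector
  exact ⟨v, hv.2, hv.apply_eq_smul⟩

/-- Serves to make `sigmaOne` continuous, hence measurable and bounded on bounded samples. -/
theorem sigmaOne_eq_norm (A : Matrix (Fin d) (Fin d) ℝ) :
    sigmaOne A = ‖Matrix.toEuclideanCLM (n := Fin d) (𝕜 := ℝ) A‖ := by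
  refine le_antisymm ?_ (ContinuousLinearMap.opNorm_le_bound _ (sigmaOne_nonneg A)
    (norm_toEuclideanLin_apply_le A))
  rcases Nat.eq_zero_or_pos d with rfl | hd
  · have : sigmaOne A = 0 := LinearMap.singularValues_of_finrank_le _ (by simp)
    rw [this]; positivity
  have : NeZero d := ⟨hd.ne'⟩
  obtain ⟨v, hv0, hv⟩ := exists_adjoint_comp_self_eq_sigmaOne_sq A
  set T := Matrix.toEuclideanLin A with hT
  have h1 : ‖T v‖ = sigmaOne A * ‖v‖ := by
    refine (sq_eq_sq₀ (norm_nonneg _) (mul_nonneg (sigmaOne_nonneg A) (norm_nonneg v))).1 ?_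
    rw [← real_inner_self_eq_norm_sq, ← LinearMap.adjoint_inner_right, hv, inner_smul_right,
      real_inner_self_eq_norm_sq, mul_pow]
  have h2 : ‖T v‖ ≤ _ := (Matrix.toEuclideanCLM (n := Fin d) (𝕜 := ℝ) A).le_opNorm v
  rw [h1] at h2
  exact le_of_mul_le_mul_right h2 (norm_pos_iff.2 hv0)

theorem continuous_sigmaOne : Continuous (sigmaOne : Matrix (Fin d) (Fin d) ℝ → ℝ) := by
  have : (sigmaOne : Matrix (Fin d) (Fin d) ℝ → ℝ) =
      fun A => ‖Matrix.toEuclideanCLM (n := Fin d) (𝕜 := ℝ) A‖ := funext sigmaOne_eq_norm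
  rw [this]
  exact (LinearMap.continuous_of_finiteDimensional
    ((Matrix.toEuclideanCLM (n := Fin d) (𝕜 := ℝ)).toAlgEquiv.toLinearMap)).norm

theorem dotProduct_mulVec_le_sigmaOne (A : Matrix (Fin d) (Fin d) ℝ) (x : Fin d → ℝ) :
    x ⬝ᵥ A *ᵥ x ≤ sigmaOne A * (x ⬝ᵥ x) := by
  set v : EuclideanSpace ℝ (Fin d) := WithLp.toLp 2 x with hv
  have h1 : x ⬝ᵥ A *ᵥ x = inner ℝ v (Matrix.toEuclideanLin A v) := by
    rw [hv, Matrix.toLpLin_toLp, EuclideanSpace.inner_toLp_toLp, star_trivial,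
      dotProduct_comm, Matrix.toLin'_apply]
  have h2 : x ⬝ᵥ x = ‖v‖ ^ 2 := by
    rw [← real_inner_self_eq_norm_sq, hv, EuclideanSpace.inner_toLp_toLp, star_trivial]
  rw [h1, h2]
  have h3 := (real_inner_le_norm v (Matrix.toEuclideanLin A v)).trans
    (mul_le_mul_of_nonneg_left (norm_toEuclideanLin_apply_le A v) (norm_nonneg v))
  linarith

/-- The maximum singular value of a positive semidefinite matrix is one of its eigenvalues. -/
theorem exists_mulVec_eq_sigmaOne [NeZero d] {A : Matrix (Fin d) (Fin d) ℝ} (hA : A.PosSemidef) :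
    ∃ w : Fin d → ℝ, w ≠ 0 ∧ A *ᵥ w = sigmaOne A • w := by
  obtain ⟨v, hv0, hv⟩ := exists_adjoint_comp_self_eq_sigmaOne_sq A
  rw [← Matrix.toEuclideanLin_conjTranspose_eq_adjoint, hA.1.eq] at hv
  set x : Fin d → ℝ := WithLp.ofLp v with hx
  have hx0 : x ≠ 0 := by
    intro h; exact hv0 ((WithLp.ofLp_eq_zero 2).1 h)
  have hAx : A *ᵥ (A *ᵥ x) = sigmaOne A ^ 2 • x := by
    have := congrArg WithLp.ofLp hv
    simpa [Matrix.ofLp_toLpLin] using this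
  -- Since `(A - σ)(A + σ) x = 0`, the vector `(A + σ) x` is an eigenvector for `σ` unless it
  -- vanishes; in that case positivity forces `σ = 0`, and `x` itself works.
  by_cases hw : A *ᵥ x + sigmaOne A • x = 0
  · have h1 : x ⬝ᵥ A *ᵥ x + sigmaOne A * (x ⬝ᵥ x) = 0 := by
      have := congrArg (x ⬝ᵥ ·) hw
      simpa [dotProduct_add, dotProduct_smul] using this
    have h2 : 0 ≤ x ⬝ᵥ A *ᵥ x := by simpa using hA.dotProduct_mulVec_nonneg x
    have h3 : 0 < x ⬝ᵥ x := by
      simpa using Matrix.dotProduct_star_self_pos_iff.2 hx0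
    have h4 : sigmaOne A = 0 := by
      have := sigmaOne_nonneg A
      nlinarith
    refine ⟨x, hx0, ?_⟩
    simpa [h4] using hw
  · refine ⟨_, hw, ?_⟩
    rw [Matrix.mulVec_add, hAx, Matrix.mulVec_smul, smul_add, smul_smul, sq, add_comm]

theorem sigmaOne_pow_le_trace {A : Matrix (Fin d) (Fin d) ℝ} (hA : A.PosSemidef) {n : ℕ}
    (hn : n ≠ 0) : sigmaOne A ^ n ≤ (A ^ n).trace := by
  rcases Nat.eq_zero_or_pos d with rfl | hd
  · have : sigmaOne A = 0 := LinearMap.singularValues_of_finrank_le _ (by simp)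
    simp [this, hn, Matrix.trace]
  have : NeZero d := ⟨hd.ne'⟩
  obtain ⟨w, hw0, hw⟩ := exists_mulVec_eq_sigmaOne hA
  have hp : ∀ m : ℕ, (A ^ m) *ᵥ w = sigmaOne A ^ m • w := by
    intro m
    induction m with
    | zero => simp
    | succ m ih =>
      rw [pow_succ, ← Matrix.mulVec_mulVec, hw, Matrix.mulVec_smul, ih, smul_smul, pow_succ,
        mul_comm]
  have h1 := (hA.pow n).dotProduct_mulVec_le_trace w
  have h3 : 0 < w ⬝ᵥ w := by simpa using Matrix.dotProduct_star_self_pos_iff.2 hw0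
  rw [hp, dotProduct_smul, smul_eq_mul, mul_comm] at h1
  exact le_of_mul_le_mul_left h1 h3

/-- Only the powers `j ≥ 1` are compared with traces; the constant term stays `1` instead of `d`. -/
theorem sum_sigmaOne_pow_le_trace_expTrunc {A : Matrix (Fin d) (Fin d) ℝ} (hA : A.PosSemidef)
    (N : ℕ) :
    ∑ j ∈ Finset.range (N + 1), sigmaOne A ^ j / (j.factorial : ℝ) ≤
      1 + (expTrunc N A).trace := by
  rw [Finset.sum_range_succ', expTrunc, Matrix.trace_sum, add_comm]
  simp only [pow_zero, Nat.factorial_zero, Nat.cast_one, div_one, Matrix.trace_smul, smul_eq_mul]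
  gcongr with j _
  rw [div_eq_inv_mul]
  exact mul_le_mul_of_nonneg_left (sigmaOne_pow_le_trace hA j.succ_ne_zero) (by positivity)

end SingularValue

/-! ### Averaging over the independent sample -/

section Sampling

variable {d K : ℕ}

theorem outerSelf_eq_vecMulVec (y : EuclideanSpace ℝ (Fin d)) :
    outerSelf y = Matrix.vecMulVec (WithLp.ofLp y) (WithLp.ofLp y) := rfl

theorem outerSelf_posSemidef (y : EuclideanSpace ℝ (Fin d)) : (outerSelf y).PosSemidef := by
  rw [outerSelf_eq_vecMulVec]
  simpa using Matrix.posSemidef_vecMulVec_self_star (WithLp.ofLp y)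

theorem dotProduct_self_eq_norm_sq (y : EuclideanSpace ℝ (Fin d)) :
    WithLp.ofLp y ⬝ᵥ WithLp.ofLp y = ‖y‖ ^ 2 := by
  rw [EuclideanSpace.real_norm_sq_eq]
  simp only [dotProduct, sq]

theorem continuous_outerSelf :
    Continuous (outerSelf : EuclideanSpace ℝ (Fin d) → Matrix (Fin d) (Fin d) ℝ) := by
  refine continuous_matrix fun i j => ?_
  simp only [outerSelf, Matrix.of_apply]
  fun_prop

theorem continuous_expTrunc {ι : Type*} [Fintype ι] [DecidableEq ι] (N : ℕ) :
    Continuous (expTrunc N : Matrix ι ι ℝ → Matrix ι ι ℝ) := by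
  unfold expTrunc
  fun_prop

theorem continuous_sum_outerSelf {κ : Type*} (s : Finset κ) :
    Continuous fun y : κ → EuclideanSpace ℝ (Fin d) => ∑ k ∈ s, outerSelf (y k) :=
  continuous_finsetSum _ fun k _ => continuous_outerSelf.comp (continuous_apply k)

theorem sum_outerSelf_posSemidef {κ : Type*} (s : Finset κ)
    (y : κ → EuclideanSpace ℝ (Fin d)) : (∑ k ∈ s, outerSelf (y k)).PosSemidef :=
  Matrix.posSemidef_sum _ fun k _ => outerSelf_posSemidef (y k)

theorem secondMoment_isHermitian (P : Measure (EuclideanSpace ℝ (Fin d))) :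
    (secondMoment P).IsHermitian := by
  ext i j
  simp [secondMoment, outerSelf, mul_comm]

variable {Ω : Type*} [MeasurableSpace Ω] {μ : Measure Ω} [IsProbabilityMeasure μ]
  {Y : Fin K → Ω → EuclideanSpace ℝ (Fin d)}

/-- The sample lies almost surely in a compact ball, where `f` is bounded. -/
theorem integrable_continuous_comp (hY : ∀ k, AEMeasurable (Y k) μ)
    (hb : ∀ᵐ ω ∂μ, ∀ k, ‖Y k ω‖ ≤ 1) {f : (Fin K → EuclideanSpace ℝ (Fin d)) → ℝ}
    (hf : Continuous f) : Integrable (fun ω => f fun k => Y k ω) μ := by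
  obtain ⟨C, hC⟩ := (isCompact_closedBall (0 : Fin K → EuclideanSpace ℝ (Fin d))
    1).exists_bound_of_continuousOn hf.continuousOn
  refine Integrable.of_bound
    (hf.measurable.comp_aemeasurable (aemeasurable_pi_lambda _ hY)).aestronglyMeasurable C ?_
  filter_upwards [hb] with ω hω
  exact hC _ (by rw [mem_closedBall_zero_iff]; exact (pi_norm_le_iff_of_nonneg zero_le_one).2 hω)

/-- As `k ∉ s`, the vector `Y k` is independent of the matrix, so the expectation factors entrywise
into the trace of (mean matrix) times `Σ`. -/
theorem integral_dotProduct_expTrunc_le {P : Measure (EuclideanSpace ℝ (Fin d))}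
    (hlaw : ∀ k, HasLaw (Y k) P μ) (hindep : iIndepFun Y μ)
    (hb : ∀ᵐ ω ∂μ, ∀ k, ‖Y k ω‖ ≤ 1) (N : ℕ) {s : Finset (Fin K)} {k : Fin K} (hk : k ∉ s) :
    ∫ ω, WithLp.ofLp (Y k ω) ⬝ᵥ (expTrunc N (∑ l ∈ s, outerSelf (Y l ω))) *ᵥ
        WithLp.ofLp (Y k ω) ∂μ ≤
      sigmaOne (secondMoment P) * ∫ ω, (expTrunc N (∑ l ∈ s, outerSelf (Y l ω))).trace ∂μ := by
  have hm : ∀ k, AEMeasurable (Y k) μ := fun k => (hlaw k).aemeasurable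
  set M : Ω → Matrix (Fin d) (Fin d) ℝ :=
    fun ω => expTrunc N (∑ l ∈ s, outerSelf (Y l ω)) with hM
  have hcont : Continuous fun y : Fin K → EuclideanSpace ℝ (Fin d) =>
      expTrunc N (∑ l ∈ s, outerSelf (y l)) :=
    (continuous_expTrunc N).comp (continuous_sum_outerSelf s)
  have hMint : ∀ i j, Integrable (fun ω => M ω i j) μ := fun i j =>
    integrable_continuous_comp hm hb (hcont.matrix_elem i j)
  have hMYint : ∀ i j, Integrable (fun ω => M ω i j * outerSelf (Y k ω) i j) μ := fun i j =>
    integrable_continuous_comp hm hb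
      (f := fun y => expTrunc N (∑ l ∈ s, outerSelf (y l)) i j * outerSelf (y k) i j)
      ((hcont.matrix_elem i j).mul
        ((continuous_outerSelf.comp (continuous_apply k)).matrix_elem i j))
  have hprod : ∀ i j, ∫ ω, M ω i j * outerSelf (Y k ω) i j ∂μ =
      (∫ ω, M ω i j ∂μ) * secondMoment P i j := by
    intro i j
    have hind := hindep.indepFun_finset₀ s {k} (Finset.disjoint_singleton_right.2 hk) hm
    have hφ : Measurable fun g : s → EuclideanSpace ℝ (Fin d) =>
        expTrunc N (∑ l, outerSelf (g l)) i j :=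
      (((continuous_expTrunc N).comp
        (continuous_sum_outerSelf Finset.univ)).matrix_elem i j).measurable
    have hψ : Measurable fun g : ({k} : Finset (Fin K)) → EuclideanSpace ℝ (Fin d) =>
        outerSelf (g ⟨k, Finset.mem_singleton_self k⟩) i j :=
      ((continuous_outerSelf.comp (continuous_apply
        (⟨k, Finset.mem_singleton_self k⟩ : ({k} : Finset (Fin K))))).matrix_elem i j).measurable
    have hind' := hind.comp hφ hψ
    have h1 : (fun g : s → EuclideanSpace ℝ (Fin d) => expTrunc N (∑ l, outerSelf (g l)) i j) ∘
        (fun a (l : s) => Y l a) = fun ω => M ω i j := by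
      funext ω
      simp only [Function.comp_apply, hM]
      rw [Finset.sum_coe_sort s (fun l => outerSelf (Y l ω))]
    have h2 : (fun g : ({k} : Finset (Fin K)) → EuclideanSpace ℝ (Fin d) =>
        outerSelf (g ⟨k, Finset.mem_singleton_self k⟩) i j) ∘
        (fun a (l : ({k} : Finset (Fin K))) => Y l a) = fun ω => outerSelf (Y k ω) i j := rfl
    rw [h1, h2] at hind'
    have hYm : AEStronglyMeasurable (fun ω => outerSelf (Y k ω) i j) μ :=
      (integrable_continuous_comp hm hb (f := fun y => outerSelf (y k) i j)
        ((continuous_outerSelf.comp (continuous_apply k)).matrix_elem i j)).1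
    rw [hind'.integral_fun_mul_eq_mul_integral (hMint i j).1 hYm]
    congr 1
    exact (hlaw k).integral_comp (f := fun y => outerSelf y i j)
      (continuous_outerSelf.matrix_elem i j).aestronglyMeasurable
  have hsym := secondMoment_isHermitian P
  calc ∫ ω, WithLp.ofLp (Y k ω) ⬝ᵥ M ω *ᵥ WithLp.ofLp (Y k ω) ∂μ
      = ∫ ω, ∑ i, ∑ j, M ω i j * outerSelf (Y k ω) i j ∂μ := by
        refine integral_congr_ae (ae_of_all _ fun ω => ?_)
        simp only [dotProduct, Matrix.mulVec, Finset.mul_sum, outerSelf, Matrix.of_apply]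
        exact Finset.sum_congr rfl fun i _ => Finset.sum_congr rfl fun j _ => by ring
    _ = ∑ i, ∑ j, (∫ ω, M ω i j ∂μ) * secondMoment P i j := by
        rw [integral_finsetSum _ fun i _ => integrable_finsetSum _ fun j _ => hMYint i j]
        refine Finset.sum_congr rfl fun i _ => ?_
        rw [integral_finsetSum _ fun j _ => hMYint i j]
        exact Finset.sum_congr rfl fun j _ => hprod i j
    _ = ∫ ω, (M ω * secondMoment P).trace ∂μ := by
        simp only [Matrix.trace, Matrix.diag_apply, Matrix.mul_apply]
        rw [integral_finsetSum _ fun i _ => integrable_finsetSum _ fun j _ =>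
          (hMint i j).mul_const _]
        refine Finset.sum_congr rfl fun i _ => ?_
        rw [integral_finsetSum _ fun j _ => (hMint i j).mul_const _]
        refine Finset.sum_congr rfl fun j _ => ?_
        rw [integral_mul_const, ← hsym.apply i j, star_trivial]
    _ ≤ ∫ ω, sigmaOne (secondMoment P) * (M ω).trace ∂μ := by
        refine integral_mono
          (integrable_continuous_comp hm hb (hcont.matrix_mul continuous_const).matrix_trace)
          ((integrable_continuous_comp hm hb hcont.matrix_trace).const_mul _) fun ω => ?_
        exact (expTrunc_posSemidef (sum_outerSelf_posSemidef s _) N).trace_mul_le hsym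
          (dotProduct_mulVec_le_sigmaOne _)
    _ = _ := integral_const_mul _ _

/-- Each new sample gives `f' ≤ (1 + c r) f + c`, starting from `0`; the right-hand side is the
exact solution of this recursion. -/
theorem integral_trace_expTrunc_le {P : Measure (EuclideanSpace ℝ (Fin d))}
    (hlaw : ∀ k, HasLaw (Y k) P μ) (hindep : iIndepFun Y μ)
    (hb : ∀ᵐ ω ∂μ, ∀ k, ‖Y k ω‖ ≤ 1) (hpos : 0 < sigmaOne (secondMoment P)) (N : ℕ)
    (s : Finset (Fin K)) :
    ∫ ω, (expTrunc N (∑ l ∈ s, outerSelf (Y l ω))).trace ∂μ ≤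
      ((1 + (Real.exp 1 - 1) * sigmaOne (secondMoment P)) ^ s.card - 1) /
        sigmaOne (secondMoment P) := by
  have hm : ∀ k, AEMeasurable (Y k) μ := fun k => (hlaw k).aemeasurable
  have hc : 0 ≤ Real.exp 1 - 1 := by have := Real.add_one_le_exp (1 : ℝ); linarith
  induction s using Finset.induction_on with
  | empty => simp [expTrunc]
  | insert k s hk ih =>
    have hcont : ∀ s : Finset (Fin K), Continuous fun y : Fin K → EuclideanSpace ℝ (Fin d) =>
        expTrunc N (∑ l ∈ s, outerSelf (y l)) := fun s =>
      (continuous_expTrunc N).comp (continuous_sum_outerSelf s)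
    have hofLp : Continuous fun y : Fin K → EuclideanSpace ℝ (Fin d) => WithLp.ofLp (y k) := by
      fun_prop
    have hi1 : Integrable (fun ω => (expTrunc N (∑ l ∈ s, outerSelf (Y l ω))).trace) μ :=
      integrable_continuous_comp hm hb (hcont s).matrix_trace
    have hi2 : Integrable (fun ω => WithLp.ofLp (Y k ω) ⬝ᵥ
        (expTrunc N (∑ l ∈ s, outerSelf (Y l ω))) *ᵥ WithLp.ofLp (Y k ω)) μ :=
      integrable_continuous_comp hm hb (hofLp.dotProduct ((hcont s).matrix_mulVec hofLp))
    have hi3 : Integrable (fun ω => (Real.exp 1 - 1) * (1 + WithLp.ofLp (Y k ω) ⬝ᵥ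
        (expTrunc N (∑ l ∈ s, outerSelf (Y l ω))) *ᵥ WithLp.ofLp (Y k ω))) μ :=
      ((integrable_const 1).add hi2).const_mul _
    have hstep : ∫ ω, (expTrunc N (∑ l ∈ insert k s, outerSelf (Y l ω))).trace ∂μ ≤
        ∫ ω, ((expTrunc N (∑ l ∈ s, outerSelf (Y l ω))).trace + (Real.exp 1 - 1) *
          (1 + WithLp.ofLp (Y k ω) ⬝ᵥ (expTrunc N (∑ l ∈ s, outerSelf (Y l ω))) *ᵥ
            WithLp.ofLp (Y k ω))) ∂μ := by
      refine integral_mono_ae (integrable_continuous_comp hm hb (hcont _).matrix_trace)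
        (hi1.add hi3) ?_
      filter_upwards [hb] with ω hω
      have hy : WithLp.ofLp (Y k ω) ⬝ᵥ WithLp.ofLp (Y k ω) ≤ 1 := by
        rw [dotProduct_self_eq_norm_sq]
        exact pow_le_one₀ (norm_nonneg _) (hω k)
      rw [Finset.sum_insert hk, add_comm (outerSelf _), outerSelf_eq_vecMulVec (Y k ω)]
      refine (trace_expTrunc_add_vecMulVec_le
        (sum_outerSelf_posSemidef s fun l => Y l ω) hy N).trans ?_
      gcongr
    refine hstep.trans ?_
    rw [integral_add hi1 hi3, integral_const_mul,
      integral_add (integrable_const 1) hi2, integral_const, probReal_univ, one_smul,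
      Finset.card_insert_of_notMem hk]
    have h1 := integral_dotProduct_expTrunc_le hlaw hindep hb N hk
    set r := sigmaOne (secondMoment P)
    set c := Real.exp 1 - 1
    set f := ∫ ω, (expTrunc N (∑ l ∈ s, outerSelf (Y l ω))).trace ∂μ
    calc _ ≤ f + c * (1 + r * f) := by gcongr
      _ = (1 + c * r) * f + c := by ring
      _ ≤ (1 + c * r) * (((1 + c * r) ^ s.card - 1) / r) + c := by gcongr
      _ = _ := by field_simp; ring

/-- A dimension-free exponential moment bound for the largest singular value of a sum of
independent rank-one matrices. -/
theorem integral_exp_sigmaOne_le {P : Measure (EuclideanSpace ℝ (Fin d))}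
    (hlaw : ∀ k, HasLaw (Y k) P μ) (hindep : iIndepFun Y μ)
    (hb : ∀ᵐ ω ∂μ, ∀ k, ‖Y k ω‖ ≤ 1) (hpos : 0 < sigmaOne (secondMoment P))
    (hle : sigmaOne (secondMoment P) ≤ 1) :
    ∫ ω, Real.exp (sigmaOne (sampleSecondMoment fun k => Y k ω)) ∂μ ≤
      (1 + (Real.exp 1 - 1) * sigmaOne (secondMoment P)) ^ K / sigmaOne (secondMoment P) := by
  have hm : ∀ k, AEMeasurable (Y k) μ := fun k => (hlaw k).aemeasurable
  have hcS : Continuous fun y : Fin K → EuclideanSpace ℝ (Fin d) =>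
      sigmaOne (sampleSecondMoment y) :=
    continuous_sigmaOne.comp (continuous_sum_outerSelf Finset.univ)
  have hcN : ∀ N, Continuous fun y : Fin K → EuclideanSpace ℝ (Fin d) =>
      ∑ j ∈ Finset.range N, sigmaOne (sampleSecondMoment y) ^ j / (j.factorial : ℝ) := fun N =>
    continuous_finsetSum _ fun j _ => (hcS.pow j).div_const _
  have hlim : Filter.Tendsto (fun N : ℕ => ∫ ω, ∑ j ∈ Finset.range (N + 1),
      sigmaOne (sampleSecondMoment fun k => Y k ω) ^ j / (j.factorial : ℝ) ∂μ) Filter.atTop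
      (nhds (∫ ω, Real.exp (sigmaOne (sampleSecondMoment fun k => Y k ω)) ∂μ)) := by
    refine tendsto_integral_of_dominated_convergence
      (fun ω => Real.exp (sigmaOne (sampleSecondMoment fun k => Y k ω)))
      (fun N => (integrable_continuous_comp hm hb (hcN (N + 1))).1)
      (integrable_continuous_comp hm hb (Real.continuous_exp.comp hcS))
      (fun N => ae_of_all _ fun ω => ?_) (ae_of_all _ fun ω => ?_)
    · rw [Real.norm_of_nonneg (Finset.sum_nonneg fun j _ =>
        div_nonneg (pow_nonneg (sigmaOne_nonneg _) j) (Nat.cast_nonneg _))]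
      exact Real.sum_le_exp_of_nonneg (sigmaOne_nonneg _) _
    · have := NormedSpace.expSeries_div_hasSum_exp
        (sigmaOne (sampleSecondMoment fun k => Y k ω))
      rw [← Real.exp_eq_exp_ℝ] at this
      exact (Filter.tendsto_add_atTop_iff_nat 1).2 this.tendsto_sum_nat
  refine le_of_tendsto' hlim fun N => ?_
  have htr : Integrable (fun ω => (expTrunc N (∑ l, outerSelf (Y l ω))).trace) μ :=
    integrable_continuous_comp hm hb
      ((continuous_expTrunc N).comp (continuous_sum_outerSelf Finset.univ)).matrix_trace
  have h1 : ∫ ω, ∑ j ∈ Finset.range (N + 1),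
      sigmaOne (sampleSecondMoment fun k => Y k ω) ^ j / (j.factorial : ℝ) ∂μ ≤
      ∫ ω, (1 + (expTrunc N (∑ l, outerSelf (Y l ω))).trace) ∂μ := by
    refine integral_mono (integrable_continuous_comp hm hb (hcN (N + 1)))
      ((integrable_const 1).add htr) fun ω => ?_
    exact sum_sigmaOne_pow_le_trace_expTrunc (sum_outerSelf_posSemidef Finset.univ _) N
  have h2 := integral_trace_expTrunc_le hlaw hindep hb hpos N Finset.univ
  rw [integral_add (integrable_const 1) htr, integral_const, probReal_univ, one_smul] at h1
  refine h1.trans ((add_le_add_right h2 1).trans ?_)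
  rw [Finset.card_univ, Fintype.card_fin, sub_div]
  -- Since `r ≤ 1`, the leftover `1 - 1 / r` is at most `0`.
  have : 1 ≤ 1 / sigmaOne (secondMoment P) := by rwa [le_div_iff₀ hpos, one_mul]
  linarith

/-- `α² ≤ E‖Y‖² = tr Σ ≤ d σ₁(Σ)`. -/
theorem sigmaOne_secondMoment_pos {P : Measure (EuclideanSpace ℝ (Fin d))}
    [IsProbabilityMeasure P] {α : ℝ} (hα : 0 < α) (hP : ∀ᵐ y ∂P, α ≤ ‖y‖ ∧ ‖y‖ ≤ 1) :
    0 < sigmaOne (secondMoment P) := by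
  have hi : ∀ i j, Integrable (fun y => outerSelf y i j) P := fun i j =>
    integrable_continuous_comp (K := 1) (Y := fun _ y => y) (fun _ => aemeasurable_id)
      (hP.mono fun y hy _ => hy.2) (f := fun y => outerSelf (y 0) i j)
      ((continuous_outerSelf.comp (continuous_apply 0)).matrix_elem i j)
  have hn : ∀ y : EuclideanSpace ℝ (Fin d), ∑ i, outerSelf y i i = ‖y‖ ^ 2 := fun y => by
    rw [← dotProduct_self_eq_norm_sq]; rfl
  have htr : α ^ 2 ≤ (secondMoment P).trace := by
    have h1 : (secondMoment P).trace = ∫ y, ‖y‖ ^ 2 ∂P := by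
      simp only [Matrix.trace, Matrix.diag_apply, secondMoment, Matrix.of_apply, ← hn]
      rw [integral_finsetSum _ fun i _ => hi i i]
    have h2 : ∫ _, α ^ 2 ∂P ≤ ∫ y, ‖y‖ ^ 2 ∂P := by
      refine integral_mono_ae (integrable_const _) ?_ ?_
      · simp only [← hn]
        exact integrable_finsetSum _ fun i _ => hi i i
      · filter_upwards [hP] with y hy
        exact pow_le_pow_left₀ hα.le hy.1 2
    rw [h1]
    simpa using h2
  have hle : (secondMoment P).trace ≤ sigmaOne (secondMoment P) * (1 : Matrix (Fin d) (Fin d) ℝ).trace := by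
    simpa using Matrix.PosSemidef.one.trace_mul_le (secondMoment_isHermitian P)
      (dotProduct_mulVec_le_sigmaOne (secondMoment P))
  refine lt_of_le_of_ne (sigmaOne_nonneg _) fun h => ?_
  rw [← h, zero_mul] at hle
  have := pow_pos hα 2
  linarith

end Sampling

/-! ### From the exponential moment to the expectation -/

theorem theorem2p2 {d K : ℕ}
    (P : Measure (EuclideanSpace ℝ (Fin d))) [IsProbabilityMeasure P]
    (ρ α : ℝ) (hρ_nonneg : 0 ≤ ρ) (hρ : ρ ^ 2 = sigmaOne (secondMoment P))
    (hα : ρ < α) (hP : ∀ᵐ y ∂P, α ≤ ‖y‖ ∧ ‖y‖ ≤ 1)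
    {Ω : Type*} [MeasurableSpace Ω] (μ : Measure Ω) [IsProbabilityMeasure μ]
    (Y : Fin K → Ω → EuclideanSpace ℝ (Fin d))
    (hY_law : ∀ k, HasLaw (Y k) P μ) (hY_indep : iIndepFun Y μ)
    (hK : 4 / ρ ^ 2 * Real.log (11 / (ρ ^ 2 * (α ^ 2 - ρ ^ 2))) < (K : ℝ)) :
    Integrable (fun ω => sigmaOne (sampleSecondMoment fun k => Y k ω) / (K : ℝ)) μ ∧
      ∫ ω, sigmaOne (sampleSecondMoment fun k => Y k ω) / (K : ℝ) ∂μ ≤ 5 * ρ ^ 2 := by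
  have hm : ∀ k, AEMeasurable (Y k) μ := fun k => (hY_law k).aemeasurable
  have hb : ∀ᵐ ω ∂μ, ∀ k, ‖Y k ω‖ ≤ 1 := by
    refine ae_all_iff.2 fun k => ?_
    have h : ∀ᵐ y ∂(μ.map (Y k)), ‖y‖ ≤ 1 := by
      rw [(hY_law k).map_eq]
      exact hP.mono fun y hy => hy.2
    exact ae_of_ae_map (hm k) h
  have hcS : Continuous fun y : Fin K → EuclideanSpace ℝ (Fin d) =>
      sigmaOne (sampleSecondMoment y) :=
    continuous_sigmaOne.comp (continuous_sum_outerSelf Finset.univ)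
  have hint := integrable_continuous_comp hm hb hcS
  have hexp : Integrable
      (fun ω => Real.exp (sigmaOne (sampleSecondMoment fun k => Y k ω))) μ :=
    integrable_continuous_comp hm hb (Real.continuous_exp.comp hcS)
  refine ⟨hint.div_const _, ?_⟩
  have hpos : 0 < ρ ^ 2 := hρ ▸ sigmaOne_secondMoment_pos (hρ_nonneg.trans_lt hα) hP
  have hα1 : α ≤ 1 := by
    obtain ⟨y, hy⟩ := hP.exists
    exact hy.1.trans hy.2
  have hρ1 : ρ ^ 2 ≤ 1 := pow_le_one₀ hρ_nonneg (hα.le.trans hα1)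
  have hgap : 0 < α ^ 2 - ρ ^ 2 := sub_pos.2 (pow_lt_pow_left₀ hα hρ_nonneg two_ne_zero)
  have hgap1 : α ^ 2 - ρ ^ 2 ≤ 1 := by
    have := pow_le_one₀ (n := 2) (hρ_nonneg.trans hα.le) hα1
    linarith
  -- Only `log (1 / ρ²)` is needed from the threshold; `11` and the gap `α² - ρ² ≤ 1` merely enlarge
  -- it.
  have hlog : Real.log (1 / ρ ^ 2) ≤ Real.log (11 / (ρ ^ 2 * (α ^ 2 - ρ ^ 2))) := by
    refine Real.log_le_log (by positivity) ?_
    rw [div_le_div_iff₀ hpos (mul_pos hpos hgap)]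
    nlinarith
  have hlog0 : 0 ≤ Real.log (1 / ρ ^ 2) :=
    Real.log_nonneg (by rwa [le_div_iff₀ hpos, one_mul])
  have hKlog : 4 * Real.log (1 / ρ ^ 2) < K * ρ ^ 2 := by
    rw [div_mul_eq_mul_div, div_lt_iff₀ hpos] at hK
    linarith
  have hKpos : 0 < (K : ℝ) := by
    have : 0 < K * ρ ^ 2 := by linarith
    exact pos_of_mul_pos_left this hpos.le
  have hmain := integral_exp_sigmaOne_le hY_law hY_indep hb (hρ ▸ hpos) (hρ ▸ hρ1)
  rw [← hρ] at hmain
  set c := Real.exp 1 - 1 with hc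
  have hc0 : 0 ≤ c := by have := Real.add_one_le_exp (1 : ℝ); linarith
  have hc2 : c ≤ 2 := by have := Real.exp_one_lt_d9; linarith
  set t := Real.log (1 / ρ ^ 2) + K * (c * ρ ^ 2) with ht
  have hexp_le : ∫ ω, Real.exp (sigmaOne (sampleSecondMoment fun k => Y k ω)) ∂μ ≤
      Real.exp t := by
    refine hmain.trans ?_
    rw [ht, Real.exp_add, Real.exp_log (by positivity), Real.exp_nat_mul, div_eq_mul_one_div,
      mul_comm]
    gcongr
    rw [add_comm]
    exact Real.add_one_le_exp _
  have hσ : ∫ ω, sigmaOne (sampleSecondMoment fun k => Y k ω) ∂μ ≤ t := by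
    -- Jensen by the tangent line of `exp` at `t`: `s ≤ t - 1 + exp (s - t)`.
    have h1 : ∫ ω, sigmaOne (sampleSecondMoment fun k => Y k ω) ∂μ ≤
        ∫ ω, ((t - 1) + Real.exp (-t) *
          Real.exp (sigmaOne (sampleSecondMoment fun k => Y k ω))) ∂μ := by
      refine integral_mono hint ((integrable_const _).add (hexp.const_mul _)) fun ω => ?_
      have := Real.add_one_le_exp (-t + sigmaOne (sampleSecondMoment fun k => Y k ω))
      rw [Real.exp_add] at this
      dsimp only
      linarith
    rw [integral_add (integrable_const _) (hexp.const_mul _), integral_const, probReal_univ,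
      one_smul, integral_const_mul] at h1
    have h2 := mul_le_mul_of_nonneg_left hexp_le (Real.exp_pos (-t)).le
    rw [← Real.exp_add, neg_add_cancel, Real.exp_zero] at h2
    exact h1.trans (by linarith)
  rw [integral_div, div_le_iff₀ hKpos]
  refine hσ.trans ?_
  -- With `c ≤ 2` this gives `t ≤ (1/4 + 2) K ρ²`, well below `5 K ρ²`.
  have : K * (c * ρ ^ 2) ≤ K * (2 * ρ ^ 2) := by gcongr
  have : 0 < K * ρ ^ 2 := by positivity
  linarith
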